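/- All graphs are undirected, finite and loopless, and may have parallel edges; they are considered up to isomorphism. The degree $\deg_G(v)$ of a vertex $v$ is the number of edges incident to $v$, counted with multiplicity, and $E_G(v)$ is the set of these edges. For $r \ge 1$, $\theta_r$ is the graph with two vertices and $r$ parallel edges between them. *Immersions.* Lifting two non-parallel distinct edges $e = uv$ and $f = vw$ (so $u \ne w$) of a graph means removing $e$ and $f$ and adding a new edge $uw$. A graph $H$ is an immersion of $G$ if a graph isomorphic to $H$ can be obtained from some subgraph of $G$ by a series of liftings followed by the deletion of some isolated vertices. *Edge sums.* Let $G_1, G_2$ be graphs, let $v_i \in V(G_i)$ with $\deg_{G_1}(v_1) = \deg_{G_2}(v_2) = k'$, and let $\sigma : E_{G_1}(v_1) \to E_{G_2}(v_2)$ be a bijection. The $k'$-edge sum of $G_1$ and $G_2$ on $v_1, v_2$ with respect to $\sigma$ is obtained from the disjoint union of $G_1$ and $G_2$ by identifying $v_1$ with $v_2$, lifting each $e \in E_{G_1}(v_1)$ with $\sigma(e)$, and removing the identified vertex. A graph $G$ is a $(\le k)$-edge sum of $G_1$ and $G_2$ if it is their disjoint union or, for some $1 \le k' \le k$, a $k'$-edge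 sum of them. For a class $\mathcal{G}$ of graphs, $\mathcal{G}^{(\le k)}$ is the smallest class that contains $\mathcal{G}$ and contains every graph $G$ that is a $(\le k)$-edge sum of two graphs $G_1, G_2 \in \mathcal{G}^{(\le k)}$ with $|V(G_1)|, |V(G_2)| < |V(G)|$. Let $\mathcal{A}_k$ be the class of graphs in which all vertices, except possibly one, have degree at most $k$. **Theorem.** For every graph $G$ and every integer $k \ge 0$, $G$ has no immersion of $\theta_{k+1}$ if and only if $G \in \mathcal{A}_k^{(\le k)}$. -/

import Mathlib

open scoped Graph

universe u v u' v'

namespace Graph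

/-- The standing convention on graphs: finitely many vertices and edges, and no loops.
Parallel edges are allowed. -/
structure IsFiniteLoopless {α : Type u} {β : Type v} (G : Graph α β) : Prop where
  finite_vertexSet : V(G).Finite
  finite_edgeSet : E(G).Finite
  loopless : G.Loopless

/-- The edge-degree of `x`: the number of edges incident to `x`, counted with multiplicity. -/
noncomputable def edgeDegree {α : Type u} {β : Type v} (G : Graph α β) (x : α) : ℕ :=
  (G.incidenceSet x).ncard

/-- Isomorphism of multigraphs: a bijection of the vertices and a bijection of the edges
that preserve the ends of every edge. -/
def IsIsomorphic {α : Type u} {β : Type v} {γ : Type u'} {δ : Type v'}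
    (G : Graph α β) (H : Graph γ δ) : Prop :=
  ∃ (φ : V(G) ≃ V(H)) (ψ : E(G) ≃ E(H)), ∀ (e : E(G)) (x y : V(G)),
    G.IsLink e x y ↔ H.IsLink (ψ e) (φ x) (φ y)

/-- The graph `θ_k`: two vertices joined by `k` parallel edges. -/
def theta (k : ℕ) : Graph (Fin 2) (Fin k) :=
  banana 0 1 Set.univ

/-! ### Immersions -/

/-- The result of lifting the edges `e = uv` and `f = vw`: both are removed and a new edge with
ends `u` and `w` is added. The new edge takes over the label `e`. -/
def lift {α : Type u} {β : Type v} (G : Graph α β) (e f : β) (a b c : α)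
    (he : G.IsLink e a b) (hf : G.IsLink f b c) (hef : e ≠ f) : Graph α β where
  vertexSet := V(G)
  edgeSet := E(G) \ {f}
  IsLink g x y :=
    (g = e ∧ ((x = a ∧ y = c) ∨ (x = c ∧ y = a))) ∨ (g ≠ e ∧ g ≠ f ∧ G.IsLink g x y)
  isLink_symm := by
    intro g _
    refine ⟨?_⟩
    rintro x y (⟨h, h'⟩ | ⟨h, h', h''⟩)
    · exact Or.inl ⟨h, h'.symm.imp And.symm And.symm⟩
    · exact Or.inr ⟨h, h', h''.symm⟩
  eq_or_eq_of_isLink_of_isLink := by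
    rintro g x y z w (⟨h, h'⟩ | ⟨h, -, h'⟩) (⟨k, k'⟩ | ⟨k, -, k'⟩)
    · rcases h' with ⟨rfl, rfl⟩ | ⟨rfl, rfl⟩ <;> rcases k' with ⟨rfl, rfl⟩ | ⟨rfl, rfl⟩ <;> simp
    · exact absurd h k
    · exact absurd k h
    · exact h'.left_eq_or_eq k'
  edge_mem_iff_exists_isLink := by
    intro g
    constructor
    · rintro ⟨hg, hgf⟩
      by_cases h : g = e
      · exact ⟨a, c, Or.inl ⟨h, Or.inl ⟨rfl, rfl⟩⟩⟩
      · obtain ⟨x, y, hxy⟩ := G.exists_isLink_of_mem_edgeSet hg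
        exact ⟨x, y, Or.inr ⟨h, hgf, hxy⟩⟩
    · rintro ⟨x, y, ⟨rfl, -⟩ | ⟨-, h, h'⟩⟩
      · exact ⟨he.edge_mem, hef⟩
      · exact ⟨h'.edge_mem, h⟩
  left_mem_of_isLink := by
    rintro g x y (⟨-, ⟨rfl, -⟩ | ⟨rfl, -⟩⟩ | ⟨-, -, h⟩)
    · exact he.left_mem
    · exact hf.right_mem
    · exact h.left_mem

/-- `G'` is the result of lifting two incident edges of `G`. The two edges are not parallel
(`a ≠ c`), so that the new edge is not a loop. -/
def IsLifting {α : Type u} {β : Type v} (G G' : Graph α β) : Prop :=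
  ∃ (e f : β) (a b c : α) (he : G.IsLink e a b) (hf : G.IsLink f b c) (hef : e ≠ f),
    a ≠ c ∧ G' = G.lift e f a b c he hf hef

/-- `H` is an immersion of `G`: a graph isomorphic to `H` is obtained from some subgraph `G₀` of
`G` by a series of liftings, followed by the deletion of some isolated vertices. (A lifting keeps
the common end of the two edges, which may become isolated.) -/
def IsImmersion {γ : Type u'} {δ : Type v'} {α : Type u} {β : Type v}
    (H : Graph γ δ) (G : Graph α β) : Prop :=
  ∃ G₀ G₁ G₂ : Graph α β, G₀ ≤ G ∧ Relation.ReflTransGen IsLifting G₀ G₁ ∧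
    G₂ ≤ G₁ ∧ E(G₂) = E(G₁) ∧ IsIsomorphic H G₂

/-! ### Edge sums -/

/-- The incidence relation of the disjoint union of two graphs. -/
inductive DisjointUnionLink {α₁ α₂ : Type u} {β₁ β₂ : Type v}
    (G₁ : Graph α₁ β₁) (G₂ : Graph α₂ β₂) : β₁ ⊕ β₂ → α₁ ⊕ α₂ → α₁ ⊕ α₂ → Prop
  | left {e x y} : G₁.IsLink e x y → DisjointUnionLink G₁ G₂ (.inl e) (.inl x) (.inl y)
  | right {e x y} : G₂.IsLink e x y → DisjointUnionLink G₁ G₂ (.inr e) (.inr x) (.inr y)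

/-- The disjoint union of two graphs. -/
def disjointUnion {α₁ α₂ : Type u} {β₁ β₂ : Type v}
    (G₁ : Graph α₁ β₁) (G₂ : Graph α₂ β₂) : Graph (α₁ ⊕ α₂) (β₁ ⊕ β₂) where
  vertexSet := Sum.inl '' V(G₁) ∪ Sum.inr '' V(G₂)
  IsLink := DisjointUnionLink G₁ G₂
  isLink_symm := by
    intro g _
    refine ⟨?_⟩
    rintro _ _ (h | h)
    · exact .left h.symm
    · exact .right h.symm
  eq_or_eq_of_isLink_of_isLink := by
    rintro g _ _ _ _ (h | h) (k | k)
    · simpa using h.left_eq_or_eq k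
    · simpa using h.left_eq_or_eq k
  left_mem_of_isLink := by
    rintro g _ _ (h | h)
    · exact Or.inl ⟨_, h.left_mem, rfl⟩
    · exact Or.inr ⟨_, h.left_mem, rfl⟩

/-- The incidence relation of the edge sum of `G₁` and `G₂` on `v₁` and `v₂` with respect to `σ`.
The edges that avoid `v₁` and `v₂` keep their ends. For an edge `e = v₁x` of `G₁`, with
`σ e = v₂y` in `G₂`, there is one edge with ends `x` and `y`; it takes over the label `e`. -/
inductive EdgeSumLink {α₁ α₂ : Type u} {β₁ β₂ : Type v}
    (G₁ : Graph α₁ β₁) (G₂ : Graph α₂ β₂) (v₁ : α₁) (v₂ : α₂)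
    (σ : G₁.incidenceSet v₁ ≃ G₂.incidenceSet v₂) : β₁ ⊕ β₂ → α₁ ⊕ α₂ → α₁ ⊕ α₂ → Prop
  | left {e x y} : G₁.IsLink e x y → x ≠ v₁ → y ≠ v₁ →
      EdgeSumLink G₁ G₂ v₁ v₂ σ (.inl e) (.inl x) (.inl y)
  | right {e x y} : G₂.IsLink e x y → x ≠ v₂ → y ≠ v₂ →
      EdgeSumLink G₁ G₂ v₁ v₂ σ (.inr e) (.inr x) (.inr y)
  | cross {e x y} (h : G₁.IsLink e v₁ x) : x ≠ v₁ →
      G₂.IsLink (σ ⟨e, h.inc_left⟩) v₂ y → y ≠ v₂ →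
      EdgeSumLink G₁ G₂ v₁ v₂ σ (.inl e) (.inl x) (.inr y)
  | cross_symm {e x y} (h : G₁.IsLink e v₁ x) : x ≠ v₁ →
      G₂.IsLink (σ ⟨e, h.inc_left⟩) v₂ y → y ≠ v₂ →
      EdgeSumLink G₁ G₂ v₁ v₂ σ (.inl e) (.inr y) (.inl x)

/-- The edge sum of `G₁` and `G₂` on `v₁` and `v₂` with respect to the bijection `σ` from the
edges at `v₁` to the edges at `v₂`: in the disjoint union of `G₁` and `G₂`, identify `v₁` with
`v₂`, lift each edge `e` at `v₁` with `σ e`, and remove the identified vertex. -/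
def edgeSum {α₁ α₂ : Type u} {β₁ β₂ : Type v}
    (G₁ : Graph α₁ β₁) (G₂ : Graph α₂ β₂) (v₁ : α₁) (v₂ : α₂)
    (σ : G₁.incidenceSet v₁ ≃ G₂.incidenceSet v₂) : Graph (α₁ ⊕ α₂) (β₁ ⊕ β₂) where
  vertexSet := Sum.inl '' (V(G₁) \ {v₁}) ∪ Sum.inr '' (V(G₂) \ {v₂})
  IsLink := EdgeSumLink G₁ G₂ v₁ v₂ σ
  isLink_symm := by
    intro g _
    refine ⟨?_⟩
    rintro _ _ (⟨h, hx, hy⟩ | ⟨h, hx, hy⟩ | ⟨h, hx, k, hy⟩ | ⟨h, hx, k, hy⟩)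
    · exact .left h.symm hy hx
    · exact .right h.symm hy hx
    · exact .cross_symm h hx k hy
    · exact .cross h hx k hy
  eq_or_eq_of_isLink_of_isLink := by
    have key : ∀ {e x y z}, G₁.IsLink e v₁ z → G₁.IsLink e x y → x ≠ v₁ → y ≠ v₁ → False := by
      intro e x y z h h' hx hy
      rcases h.left_eq_or_eq h' with h | h
      exacts [hx h.symm, hy h.symm]
    intro g x y z w h h'
    cases h with
    | left h hx hy =>
      cases h' with
      | left k kx ky => simpa using h.left_eq_or_eq k
      | cross k => exact (key k h hx hy).elim
      | cross_symm k => exact (key k h hx hy).elim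
    | right h hx hy =>
      cases h' with
      | right k kx ky => simpa using h.left_eq_or_eq k
    | cross h hx i hy =>
      cases h' with
      | left k kx ky => exact (key h k kx ky).elim
      | cross k kx l ly => exact Or.inl (congrArg _ (h.right_unique k))
      | cross_symm k kx l ly => exact Or.inr (congrArg _ (h.right_unique k))
    | cross_symm h hx i hy =>
      cases h' with
      | left k kx ky => exact (key h k kx ky).elim
      | cross k kx l ly => exact Or.inr (congrArg _ (i.right_unique l))
      | cross_symm k kx l ly => exact Or.inl (congrArg _ (i.right_unique l))
  left_mem_of_isLink := by
    rintro g _ _ (⟨h, hx, hy⟩ | ⟨h, hx, hy⟩ | ⟨h, hx, k, hy⟩ | ⟨h, hx, k, hy⟩)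
    · exact Or.inl ⟨_, ⟨h.left_mem, hx⟩, rfl⟩
    · exact Or.inr ⟨_, ⟨h.left_mem, hx⟩, rfl⟩
    · exact Or.inl ⟨_, ⟨h.right_mem, hx⟩, rfl⟩
    · exact Or.inr ⟨_, ⟨k.right_mem, hy⟩, rfl⟩

/-- `G` is a `(≤ k)`-edge sum of `G₁` and `G₂`: up to isomorphism, it is their disjoint union or
their `k'`-edge sum on some vertices `v₁`, `v₂` of degree `k'`, where `1 ≤ k' ≤ k`. -/
def IsEdgeSumLE (k : ℕ) {α₁ α₂ α : Type u} {β₁ β₂ β : Type v}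
    (G₁ : Graph α₁ β₁) (G₂ : Graph α₂ β₂) (G : Graph α β) : Prop :=
  IsIsomorphic G (disjointUnion G₁ G₂) ∨
  ∃ k' : ℕ, 1 ≤ k' ∧ k' ≤ k ∧ ∃ v₁ ∈ V(G₁), ∃ v₂ ∈ V(G₂),
    G₁.edgeDegree v₁ = k' ∧ G₂.edgeDegree v₂ = k' ∧
    ∃ σ : G₁.incidenceSet v₁ ≃ G₂.incidenceSet v₂, IsIsomorphic G (edgeSum G₁ G₂ v₁ v₂ σ)

/-- The `(≤ k)`-sum closure of a class `𝒢` of graphs: it contains the graphs in `𝒢` and every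
graph that is a `(≤ k)`-edge sum of two members with fewer vertices. -/
inductive SumClosure (𝒢 : ∀ (α : Type u) (β : Type v), Graph α β → Prop) (k : ℕ) :
    ∀ (α : Type u) (β : Type v), Graph α β → Prop
  | base {α : Type u} {β : Type v} (G : Graph α β) : 𝒢 α β G → SumClosure 𝒢 k α β G
  | sum {α₁ α₂ α : Type u} {β₁ β₂ β : Type v}
      (G₁ : Graph α₁ β₁) (G₂ : Graph α₂ β₂) (G : Graph α β) :
      SumClosure 𝒢 k α₁ β₁ G₁ → SumClosure 𝒢 k α₂ β₂ G₂ → IsEdgeSumLE k G₁ G₂ G →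
      V(G₁).ncard < V(G).ncard → V(G₂).ncard < V(G).ncard → SumClosure 𝒢 k α β G

/-- The class `𝒜_k` of almost `k`-bounded edge-degree graphs: all vertices, except possibly one,
have edge-degree at most `k`. -/
def AlmostBounded (k : ℕ) (α : Type u) (β : Type v) (G : Graph α β) : Prop :=
  G.IsFiniteLoopless ∧ {x ∈ V(G) | ¬ G.edgeDegree x ≤ k}.Subsingleton

end Graph

namespace Graph

/-! Both sides of the equivalence are compared with `Separable`: any two vertices are separated by
an edge cut of size at most `k`.

Immersions. A lifting never enlarges a cut, so `k + 1` parallel edges obtained by liftings certify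
that no cut of size `k` separates their ends. Conversely, if every cut between `x` and `y` has more
than `k` edges, an edge form of Menger's theorem produces the parallel edges. It rests on
`exists_deletion_or_lifting`: as long as `x` has an edge to a third vertex, submodularity of the cut
function shows that some deletion or lifting keeps all these cuts large.

Sums. In a graph of the base class, one of any two vertices has degree at most `k`, and the edges at
that vertex separate the two. Separability survives edge sums: a cut of a summand can be described
by the side that avoids the identified vertex, and that side has no larger cut in the sum; vertices
from different summands are separated by the at most `k` lifted edges.

Conversely, let `u` and `v` both have degree above `k`, and take a minimum cut between them. If it
is empty, the graph is a disjoint union; otherwise it is the edge sum of the two graphs in which one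
side is collapsed to a vertex. Minimality permits uncrossing, so both collapsed graphs are separable
(`Separable.collapse`). Each has fewer vertices, because a vertex of degree above `k` cannot be a
whole side of a cut of size at most `k`. Induction on the number of vertices finishes the proof. -/

/-- The edges of `G` with one end in `S` and the other end outside `S`. -/
def cut {α : Type u} {β : Type v} (G : Graph α β) (S : Set α) : Set β :=
  {e | ∃ a b, G.IsLink e a b ∧ a ∈ S ∧ b ∉ S}

/-- Any two distinct vertices of `G` are separated by an edge cut of size at most `k`. -/
def Separable {α : Type u} {β : Type v} (G : Graph α β) (k : ℕ) : Prop :=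
  ∀ x ∈ V(G), ∀ y ∈ V(G), x ≠ y → ∃ S : Set α, x ∈ S ∧ y ∉ S ∧ (G.cut S).ncard ≤ k

/-- A map of the vertices and a map of the edges that are bijective and preserve links define an
isomorphism. -/
theorem isIsomorphic_of_bijOn {α : Type u} {β : Type v} {γ : Type u'} {δ : Type v'}
    {G : Graph α β} {H : Graph γ δ} (f : α → γ) (g : β → δ) (hf : Set.BijOn f V(G) V(H))
    (hg : Set.BijOn g E(G) E(H))
    (h : ∀ e x y, G.IsLink e x y → H.IsLink (g e) (f x) (f y)) : IsIsomorphic G H := by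
  refine ⟨hf.equiv, hg.equiv, fun e x y => ⟨h _ _ _, fun hl => ?_⟩⟩
  obtain ⟨x', y', h'⟩ := G.exists_isLink_of_mem_edgeSet e.2
  have hl' : H.IsLink (g e) (f x) (f y) := hl
  rcases hl'.eq_and_eq_or_eq_and_eq (h _ _ _ h') with ⟨hx, hy⟩ | ⟨hx, hy⟩
  · rwa [hf.injOn x.2 h'.left_mem hx, hf.injOn y.2 h'.right_mem hy]
  · rw [hf.injOn x.2 h'.right_mem hx, hf.injOn y.2 h'.left_mem hy]
    exact h'.symm

/-! ### Edge cuts and submodularity -/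

section Cut

variable {α : Type u} {β : Type v} {G : Graph α β} {S T : Set α} {e f : β} {a b c x y : α}

theorem IsLink.mem_cut_iff (h : G.IsLink e a b) : e ∈ G.cut S ↔ ¬ (a ∈ S ↔ b ∈ S) := by
  constructor
  · rintro ⟨a', b', h', ha, hb⟩
    rcases h.eq_and_eq_or_eq_and_eq h' with ⟨rfl, rfl⟩ | ⟨rfl, rfl⟩ <;> tauto
  · intro hS
    by_cases ha : a ∈ S
    · exact ⟨a, b, h, ha, by tauto⟩
    · exact ⟨b, a, h.symm, by tauto, ha⟩

theorem cut_subset_edgeSet (G : Graph α β) (S : Set α) : G.cut S ⊆ E(G) := by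
  rintro e ⟨a, b, h, -⟩
  exact h.edge_mem

theorem finite_cut (hG : E(G).Finite) (S : Set α) : (G.cut S).Finite :=
  hG.subset (G.cut_subset_edgeSet S)

theorem cut_compl (G : Graph α β) (S : Set α) : G.cut Sᶜ = G.cut S := by
  ext e
  by_cases he : e ∈ E(G)
  · obtain ⟨a, b, h⟩ := G.exists_isLink_of_mem_edgeSet he
    rw [h.mem_cut_iff, h.mem_cut_iff]
    simp only [Set.mem_compl_iff]
    tauto
  · exact iff_of_false (fun h => he (G.cut_subset_edgeSet _ h))
      (fun h => he (G.cut_subset_edgeSet _ h))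

theorem cut_inter_vertexSet (G : Graph α β) (S : Set α) : G.cut (S ∩ V(G)) = G.cut S := by
  ext e
  by_cases he : e ∈ E(G)
  · obtain ⟨a, b, h⟩ := G.exists_isLink_of_mem_edgeSet he
    rw [h.mem_cut_iff, h.mem_cut_iff]
    simp [h.left_mem, h.right_mem]
  · exact iff_of_false (fun h => he (G.cut_subset_edgeSet _ h))
      (fun h => he (G.cut_subset_edgeSet _ h))

/-- The cut function is submodular, even if one ignores a set `F` of edges that join `S \ T`
to `T \ S`. -/
theorem ncard_cut_inter_add_ncard_cut_union_le_sdiff (hG : E(G).Finite) (S T : Set α) (F : Set β)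
    (hF : ∀ e ∈ F, e ∉ G.cut (S ∩ T) ∧ e ∉ G.cut (S ∪ T)) :
    (G.cut (S ∩ T)).ncard + (G.cut (S ∪ T)).ncard ≤
      (G.cut S \ F).ncard + (G.cut T \ F).ncard := by
  -- Checking single edges gives one inclusion for unions of cuts and one for intersections;
  -- inclusion-exclusion adds the two.
  have h1 : G.cut (S ∩ T) ∪ G.cut (S ∪ T) ⊆ (G.cut S \ F) ∪ (G.cut T \ F) := by
    intro e he
    have heF : e ∉ F := fun h => by
      have := hF e h
      exact he.elim this.1 this.2
    obtain ⟨a, b, h⟩ := G.exists_isLink_of_mem_edgeSet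
      (he.elim (G.cut_subset_edgeSet _ ·) (G.cut_subset_edgeSet _ ·))
    simp only [Set.mem_union, Set.mem_sdiff, h.mem_cut_iff, Set.mem_inter_iff] at he ⊢
    tauto
  have h2 : G.cut (S ∩ T) ∩ G.cut (S ∪ T) ⊆ (G.cut S \ F) ∩ (G.cut T \ F) := by
    intro e he
    have heF : e ∉ F := fun h => (hF e h).1 he.1
    obtain ⟨a, b, h⟩ := G.exists_isLink_of_mem_edgeSet (G.cut_subset_edgeSet _ he.1)
    simp only [Set.mem_union, Set.mem_sdiff, h.mem_cut_iff, Set.mem_inter_iff] at he ⊢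
    tauto
  have fS := (finite_cut hG S).sdiff (t := F)
  have fT := (finite_cut hG T).sdiff (t := F)
  rw [← Set.ncard_union_add_ncard_inter _ _ (finite_cut hG _) (finite_cut hG _),
    ← Set.ncard_union_add_ncard_inter _ _ fS fT]
  exact add_le_add (Set.ncard_le_ncard h1 (fS.union fT))
    (Set.ncard_le_ncard h2 (fS.inter_of_left _))

theorem ncard_cut_inter_add_ncard_cut_union_le (hG : E(G).Finite) (S T : Set α) :
    (G.cut (S ∩ T)).ncard + (G.cut (S ∪ T)).ncard ≤ (G.cut S).ncard + (G.cut T).ncard := by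
  simpa using ncard_cut_inter_add_ncard_cut_union_le_sdiff hG S T ∅ (by simp)

/-- Every edge that joins `S \ T` to `T \ S` makes the submodular inequality strict by two. -/
theorem ncard_cut_inter_add_ncard_cut_union_add_two_le (hG : E(G).Finite) (S T : Set α)
    (h : G.IsLink e a b) (haS : a ∈ S) (haT : a ∉ T) (hbS : b ∉ S) (hbT : b ∈ T) :
    (G.cut (S ∩ T)).ncard + (G.cut (S ∪ T)).ncard + 2 ≤ (G.cut S).ncard + (G.cut T).ncard := by
  have key := ncard_cut_inter_add_ncard_cut_union_le_sdiff hG S T {e} (by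
    rintro _ rfl
    rw [h.mem_cut_iff, h.mem_cut_iff]
    simp [*])
  have hS : e ∈ G.cut S := by rw [h.mem_cut_iff]; tauto
  have hT : e ∈ G.cut T := by rw [h.mem_cut_iff]; tauto
  have := Set.ncard_sdiff_singleton_add_one hS (finite_cut hG S)
  have := Set.ncard_sdiff_singleton_add_one hT (finite_cut hG T)
  omega

theorem ncard_cut_mono {H : Graph α β} (h : H ≤ G) (hG : E(G).Finite) (S : Set α) :
    (H.cut S).ncard ≤ (G.cut S).ncard := by
  refine Set.ncard_le_ncard ?_ (finite_cut hG S)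
  rintro e ⟨a, b, hab, ha, hb⟩
  exact ⟨a, b, hab.mono h, ha, hb⟩

theorem cut_restrict (G : Graph α β) (F : Set β) (S : Set α) :
    (G.restrict F).cut S = G.cut S ∩ F := by
  ext e
  simp only [cut, restrict_isLink, Set.mem_ofPred_eq, Set.mem_inter_iff]
  constructor
  · rintro ⟨a, b, ⟨hF, h⟩, ha, hb⟩
    exact ⟨⟨a, b, h, ha, hb⟩, hF⟩
  · rintro ⟨⟨a, b, h, ha, hb⟩, hF⟩
    exact ⟨a, b, ⟨hF, h⟩, ha, hb⟩

end Cut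

/-! ### Liftings, Menger's theorem and immersions of theta graphs -/

section Lift

variable {α : Type u} {β : Type v} {G G' : Graph α β} {e f : β} {a b c x y : α}

theorem lift_isLink_self (he : G.IsLink e a b) (hf : G.IsLink f b c) (hef : e ≠ f) :
    (G.lift e f a b c he hf hef).IsLink e a c :=
  Or.inl ⟨rfl, Or.inl ⟨rfl, rfl⟩⟩

theorem lift_isLink_of_ne (he : G.IsLink e a b) (hf : G.IsLink f b c) (hef : e ≠ f)
    {g : β} (hge : g ≠ e) :
    (G.lift e f a b c he hf hef).IsLink g x y ↔ g ≠ f ∧ G.IsLink g x y := by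
  simp [lift, hge]

theorem mem_cut_lift_of_ne (he : G.IsLink e a b) (hf : G.IsLink f b c) (hef : e ≠ f)
    {g : β} (hge : g ≠ e) (S : Set α) :
    g ∈ (G.lift e f a b c he hf hef).cut S ↔ g ≠ f ∧ g ∈ G.cut S := by
  simp only [cut, Set.mem_ofPred_eq, lift_isLink_of_ne he hf hef hge]
  constructor
  · rintro ⟨a, b, ⟨h, h'⟩, h''⟩
    exact ⟨h, a, b, h', h''⟩
  · rintro ⟨h, a, b, h', h''⟩
    exact ⟨a, b, ⟨h, h'⟩, h''⟩

/-- Liftings do not enlarge edge cuts. -/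
theorem IsLifting.ncard_cut_le (h : IsLifting G G') (hG : E(G).Finite) (S : Set α) :
    (G'.cut S).ncard ≤ (G.cut S).ncard := by
  classical
  obtain ⟨e, f, a, b, c, he, hf, hef, hac, rfl⟩ := h
  -- If the new edge crosses `S`, then so does `e` or `f`; it is charged to `e` if possible and to
  -- `f` otherwise.
  have key : (G.lift e f a b c he hf hef).cut S ⊆
      (fun g => if g = f ∧ e ∉ G.cut S then e else g) '' G.cut S := by
    intro g hg
    by_cases hge : g = e
    · subst hge
      by_cases hgS : g ∈ G.cut S
      · exact ⟨g, hgS, by simp [hef]⟩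
      · refine ⟨f, ?_, by simp [hgS]⟩
        rw [(lift_isLink_self he hf hef).mem_cut_iff] at hg
        rw [he.mem_cut_iff] at hgS
        rw [hf.mem_cut_iff]
        tauto
    · rw [mem_cut_lift_of_ne he hf hef hge] at hg
      exact ⟨g, hg.2, by simp [hg.1]⟩
  exact (Set.ncard_le_ncard key ((finite_cut hG S).image _)).trans
    (Set.ncard_image_le (finite_cut hG S))

theorem IsLifting.edgeSet_subset (h : IsLifting G G') : E(G') ⊆ E(G) := by
  obtain ⟨e, f, a, b, c, he, hf, hef, hac, rfl⟩ := h
  exact Set.sdiff_subset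

theorem IsLifting.vertexSet_eq (h : IsLifting G G') : V(G') = V(G) := by
  obtain ⟨e, f, a, b, c, he, hf, hef, hac, rfl⟩ := h
  rfl

theorem ncard_cut_le_of_reflTransGen_isLifting (h : Relation.ReflTransGen IsLifting G G')
    (hG : E(G).Finite) (S : Set α) :
    E(G').Finite ∧ V(G') = V(G) ∧ (G'.cut S).ncard ≤ (G.cut S).ncard := by
  induction h with
  | refl => exact ⟨hG, rfl, le_rfl⟩
  | tail _ h ih =>
    exact ⟨ih.1.subset h.edgeSet_subset, h.vertexSet_eq.trans ih.2.1,
      (h.ncard_cut_le ih.1 S).trans ih.2.2⟩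

/-- A graph with an immersion of `θ_{k+1}` has two vertices that no cut of size `k` separates. -/
theorem Separable.not_isImmersion_theta {k : ℕ} (hS : G.Separable k) (hG : E(G).Finite) :
    ¬ IsImmersion (theta (k + 1)) G := by
  rintro ⟨G₀, G₁, G₂, h₀, h₁, h₂, hE, φ, ψ, hφ⟩
  have hp : (0 : Fin 2) ∈ V(theta (k + 1)) := by simp [theta]
  have hq : (1 : Fin 2) ∈ V(theta (k + 1)) := by simp [theta]
  have h₀E := hG.subset h₀.edgeSet_mono
  have hV := (ncard_cut_le_of_reflTransGen_isLifting h₁ h₀E ∅).2.1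
  have hsub : V(G₂) ⊆ V(G) := h₂.vertexSet_mono.trans (hV ▸ h₀.vertexSet_mono)
  obtain ⟨S, hxS, hyS, hSk⟩ := hS _ (hsub (φ ⟨0, hp⟩).2) _ (hsub (φ ⟨1, hq⟩).2) (by
    intro h
    have := φ.injective (Subtype.ext h)
    simp at this)
  obtain ⟨f₁, -, hle⟩ := ncard_cut_le_of_reflTransGen_isLifting h₁ h₀E S
  have h3 := (ncard_cut_mono h₂ f₁ S).trans (hle.trans (ncard_cut_mono h₀ hG S))
  have h4 : E(G₂) ⊆ G₂.cut S := by
    intro e he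
    have h5 := (hφ (ψ.symm ⟨e, he⟩) ⟨0, hp⟩ ⟨1, hq⟩).1 (by simp [theta])
    rw [Equiv.apply_symm_apply] at h5
    exact ⟨_, _, h5, hxS, hyS⟩
  have f₂ : E(G₂).Finite := hE ▸ f₁
  have h5 : E(G₂).ncard = k + 1 := by
    rw [← Nat.card_coe_set_eq, ← Nat.card_congr ψ]
    simp [theta, Set.ncard_univ]
  have := Set.ncard_le_ncard h4 (finite_cut f₂ S)
  omega

/-- Passing to a spanning subgraph commutes with liftings. -/
theorem exists_isLifting_restrict_lift (he : G.IsLink e a b) (hf : G.IsLink f b c) (hef : e ≠ f)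
    (hac : a ≠ c) (F : Set β) :
    ∃ F', Relation.ReflTransGen IsLifting (G.restrict F')
      ((G.lift e f a b c he hf hef).restrict F) := by
  -- If the new edge is kept, both `e` and `f` are needed beforehand. If it is discarded, omitting
  -- both already gives the same graph, with no lifting.
  by_cases heF : e ∈ F
  · have he' : (G.restrict (insert f F)).IsLink e a b := by simp [heF, he]
    have hf' : (G.restrict (insert f F)).IsLink f b c := by simp [hf]
    refine ⟨insert f F, .single ⟨e, f, a, b, c, he', hf', hef, hac, ?_⟩⟩
    refine Graph.ext rfl fun g x y => ?_
    by_cases hge : g = e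
    · subst hge
      simp [lift, heF]
    · rw [restrict_isLink, lift_isLink_of_ne he' hf' hef hge, restrict_isLink,
        lift_isLink_of_ne he hf hef hge, Set.mem_insert_iff]
      tauto
  · refine ⟨F \ {f}, ?_⟩
    convert Relation.ReflTransGen.refl using 1
    refine Graph.ext rfl fun g x y => ?_
    by_cases hge : g = e
    · subst hge
      simp [heF]
    · rw [restrict_isLink, restrict_isLink, lift_isLink_of_ne _ _ _ hge, Set.mem_sdiff,
        Set.mem_singleton_iff]
      tauto

/-- If the lifting of `e = xb` and `f = bc` destroys the property that all cuts between `x` and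
`y` have size at least `m`, then some cut of size at most `m + 1` has `x` and `c` on one side and
`b` and `y` on the other. -/
theorem exists_cut_of_ncard_cut_lift_lt (hG : E(G).Finite) {m : ℕ} (he : G.IsLink e x b)
    (hf : G.IsLink f b c) (hef : e ≠ f) {S : Set α} (hx : x ∈ S) (hm : m ≤ (G.cut S).ncard)
    (hS : ((G.lift e f x b c he hf hef).cut S).ncard < m) :
    b ∉ S ∧ c ∈ S ∧ (G.cut S).ncard ≤ m + 1 := by
  classical
  have fin' : ((G.lift e f x b c he hf hef).cut S).Finite :=
    (hG.subset Set.sdiff_subset).subset (cut_subset_edgeSet _ S)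
  have hself := lift_isLink_self he hf hef
  -- The cut shrinks only if `e` and `f` both cross `S` and the new edge does not; then exactly two
  -- edges are lost, whence the bound `m + 1`. In the other cases the new edge makes up for the one
  -- of `e`, `f` that crosses, if any.
  by_cases hb : b ∈ S
  · exfalso
    have key : G.cut S ⊆
        (fun g => if g = e then f else g) '' (G.lift e f x b c he hf hef).cut S := by
      intro g hg
      have hge : g ≠ e := by
        rintro rfl
        rw [he.mem_cut_iff] at hg
        tauto
      by_cases hgf : g = f
      · subst hgf
        refine ⟨e, ?_, by simp⟩
        rw [hf.mem_cut_iff] at hg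
        rw [hself.mem_cut_iff]
        tauto
      · exact ⟨g, (mem_cut_lift_of_ne he hf hef hge S).2 ⟨hgf, hg⟩, by simp [hge]⟩
    have := (Set.ncard_le_ncard key (fin'.image _)).trans (Set.ncard_image_le fin')
    omega
  · by_cases hc : c ∈ S
    · refine ⟨hb, hc, ?_⟩
      have key : G.cut S ⊆ insert e (insert f ((G.lift e f x b c he hf hef).cut S)) := by
        intro g hg
        simp only [Set.mem_insert_iff]
        by_cases hge : g = e
        · exact Or.inl hge
        by_cases hgf : g = f
        · exact Or.inr (Or.inl hgf)
        exact Or.inr (Or.inr ((mem_cut_lift_of_ne he hf hef hge S).2 ⟨hgf, hg⟩))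
      have h1 := Set.ncard_le_ncard key ((fin'.insert _).insert _)
      have h2 := Set.ncard_insert_le e (insert f ((G.lift e f x b c he hf hef).cut S))
      have h3 := Set.ncard_insert_le f ((G.lift e f x b c he hf hef).cut S)
      omega
    · exfalso
      have key : G.cut S ⊆ (G.lift e f x b c he hf hef).cut S := by
        intro g hg
        by_cases hge : g = e
        · subst hge
          rw [hself.mem_cut_iff]
          tauto
        · refine (mem_cut_lift_of_ne he hf hef hge S).2 ⟨?_, hg⟩
          rintro rfl
          rw [hf.mem_cut_iff] at hg
          tauto
      have := Set.ncard_le_ncard key fin'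
      omega

/-- One step of the edge version of Menger's theorem: if all cuts between `x` and `y` have size
at least `m`, then an edge from `x` to a third vertex can be deleted, or some other edge can be
deleted, or two edges can be lifted. -/
theorem exists_deletion_or_lifting (hG : E(G).Finite) (hV : V(G).Finite) {m : ℕ}
    (hm : ∀ S : Set α, x ∈ S → y ∉ S → m ≤ (G.cut S).ncard)
    (he : G.IsLink e x b) (hbx : b ≠ x) (hby : b ≠ y) :
    (∃ g ∈ E(G), ∀ S : Set α, x ∈ S → y ∉ S → m ≤ ((G.restrict {g}ᶜ).cut S).ncard) ∨
    ∃ (f : β) (c : α) (hf : G.IsLink f b c) (hef : e ≠ f), x ≠ c ∧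
      ∀ S : Set α, x ∈ S → y ∉ S → m ≤ ((G.lift e f x b c he hf hef).cut S).ncard := by
  by_contra! hcon
  obtain ⟨hdel, hlift⟩ := hcon
  -- Since no deletion is allowed, every edge lies in a cut of size exactly `m`. Intersecting with
  -- `V(G)` leaves finitely many candidates, so that a maximal one exists.
  have tight : ∀ g ∈ E(G), ∃ S ⊆ V(G), x ∈ S ∧ y ∉ S ∧ g ∈ G.cut S ∧ (G.cut S).ncard = m := by
    intro g hg
    obtain ⟨S, hx, hy, hS⟩ := hdel g hg
    have hgS : g ∈ G.cut S := by
      by_contra hgS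
      rw [cut_restrict, ← Set.sdiff_eq, Set.sdiff_singleton_eq_self hgS] at hS
      exact absurd (hm S hx hy) (by omega)
    rw [cut_restrict, ← Set.sdiff_eq] at hS
    have h1 := Set.ncard_sdiff_singleton_add_one hgS (finite_cut hG S)
    have h2 := hm S hx hy
    refine ⟨S ∩ V(G), Set.inter_subset_right, ⟨hx, he.left_mem⟩, fun h => hy h.1, ?_, ?_⟩
    · rwa [cut_inter_vertexSet]
    · rw [cut_inter_vertexSet]
      omega
  obtain ⟨X₀, hX₀V, hxX₀, hyX₀, heX₀, hX₀m⟩ := tight e he.edge_mem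
  have hbX₀ : b ∉ X₀ := by
    rw [he.mem_cut_iff] at heX₀
    tauto
  have hfin : {X | X ⊆ V(G) ∧ x ∈ X ∧ y ∉ X ∧ b ∉ X ∧ (G.cut X).ncard = m}.Finite :=
    hV.finite_subsets.subset (fun X h => h.1)
  obtain ⟨X, hX⟩ := hfin.exists_maximal ⟨X₀, hX₀V, hxX₀, hyX₀, hbX₀, hX₀m⟩
  obtain ⟨⟨hXV, hxX, hyX, hbX, hXm⟩, hmax⟩ := hX
  have heX : e ∈ G.cut X := by
    rw [he.mem_cut_iff]
    tauto
  -- Otherwise moving `b` into `X` would lose the edge `e` and gain none, leaving a cut of size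
  -- below `m`.
  obtain ⟨f, c, hf, hcX⟩ : ∃ f c, G.IsLink f b c ∧ c ∉ insert b X := by
    by_contra! hno
    have key : G.cut (insert b X) ⊆ G.cut X \ {e} := by
      rintro g ⟨p, q, hpq, hp, hq⟩
      rcases hp with rfl | hp
      · exact absurd (hno g q hpq) hq
      · refine ⟨⟨p, q, hpq, hp, fun h => hq (Or.inr h)⟩, ?_⟩
        rintro rfl
        rcases hpq.right_eq_or_eq he with rfl | rfl
        · exact hq (Or.inr hxX)
        · exact hq (Or.inl rfl)
    have h1 := Set.ncard_le_ncard key ((finite_cut hG X).sdiff)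
    have h2 := Set.ncard_sdiff_singleton_add_one heX (finite_cut hG X)
    have h3 := hm (insert b X) (Or.inr hxX) (by
      rintro (h | h)
      · exact hby h.symm
      · exact hyX h)
    omega
  have hcX' : c ∉ X := fun h => hcX (Or.inr h)
  have hxc : x ≠ c := by
    rintro rfl
    exact hcX' hxX
  have hef : e ≠ f := by
    rintro rfl
    exact hxc (he.symm.right_unique hf)
  obtain ⟨S, hxS, hyS, hSm⟩ := hlift f c hf hef hxc
  obtain ⟨hbS, hcS, hSm'⟩ :=
    exists_cut_of_ncard_cut_lift_lt hG he hf hef hxS (hm S hxS hyS) hSm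
  obtain ⟨W, hWV, hxW, hyW, hfW, hWm⟩ := tight f hf.edge_mem
  rw [hf.mem_cut_iff] at hfW
  -- If `b ∈ W`, then `f` joins `S \ W` to `W \ S`, and the strict inequality yields `2m + 2 ≤ (m +
  -- 1) + m`. If `b ∉ W`, submodularity makes `X ∪ W` another cut of size `m` that misses `b`; it
  -- contains `c`, against the maximality of `X`.
  by_cases hbW : b ∈ W
  · have hcW : c ∉ W := by tauto
    have h1 := ncard_cut_inter_add_ncard_cut_union_add_two_le hG S W hf.symm hcS hcW hbS hbW
    have h2 := hm (S ∩ W) ⟨hxS, hxW⟩ (fun h => hyS h.1)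
    have h3 := hm (S ∪ W) (Or.inl hxS) (fun h => h.elim hyS hyW)
    omega
  · have hcW : c ∈ W := by tauto
    have h1 := ncard_cut_inter_add_ncard_cut_union_le hG X W
    have h2 := hm (X ∩ W) ⟨hxX, hxW⟩ (fun h => hyX h.1)
    have h3 := hm (X ∪ W) (Or.inl hxX) (fun h => h.elim hyX hyW)
    have h4 := hmax (y := X ∪ W) ⟨Set.union_subset hXV hWV, Or.inl hxX,
      fun h => h.elim hyX hyW, fun h => h.elim hbX hbW, by omega⟩ Set.subset_union_left
    exact hcX' (h4 (Or.inr hcW))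

/-- The edge version of Menger's theorem: if all cuts between `x` and `y` have size at least `m`,
then liftings in a spanning subgraph lead to `m` parallel edges between `x` and `y`. -/
theorem exists_reflTransGen_isLifting_of_le_ncard_cut (hG : E(G).Finite) (hV : V(G).Finite)
    {m : ℕ} (hm : ∀ S : Set α, x ∈ S → y ∉ S → m ≤ (G.cut S).ncard) (hxy : x ≠ y) :
    ∃ F G₁, Relation.ReflTransGen IsLifting (G.restrict F) G₁ ∧ V(G₁) = V(G) ∧
      E(G₁).ncard = m ∧ ∀ e ∈ E(G₁), G₁.IsLink e x y := by
  induction hn : E(G).ncard using Nat.strong_induction_on generalizing G with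
  | _ n ih =>
  subst hn
  by_cases hno : ∃ e b, G.IsLink e x b ∧ b ≠ x ∧ b ≠ y
  · obtain ⟨e, b, he, hbx, hby⟩ := hno
    rcases exists_deletion_or_lifting hG hV hm he hbx hby with
      ⟨g, hg, hcut⟩ | ⟨f, c, hf, hef, hxc, hcut⟩
    · have hE : E(G.restrict {g}ᶜ) = E(G) \ {g} := by simp [Set.sdiff_eq]
      obtain ⟨F, G₁, h1, h2⟩ := ih _ (by
        rw [hE]; exact Set.ncard_sdiff_singleton_lt_of_mem hg hG)
        (G := G.restrict {g}ᶜ) (by rw [hE]; exact hG.sdiff) hV hcut rfl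
      rw [restrict_restrict] at h1
      exact ⟨_, G₁, h1, h2⟩
    · have hE : E(G.lift e f x b c he hf hef) = E(G) \ {f} := rfl
      obtain ⟨F, G₁, h1, h2⟩ := ih _ (by
        rw [hE]; exact Set.ncard_sdiff_singleton_lt_of_mem hf.edge_mem hG)
        (G := G.lift e f x b c he hf hef) (by rw [hE]; exact hG.sdiff) hV hcut rfl
      obtain ⟨F', hF'⟩ := exists_isLifting_restrict_lift he hf hef hxc F
      exact ⟨F', G₁, hF'.trans h1, h2⟩
  -- Every edge leaving `x` now ends at `y`, so any `m` edges of the cut around `x` will do.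
  · push Not at hno
    obtain ⟨D, hD, hDm⟩ := Set.exists_subset_card_eq (hm {x} rfl (by simpa using hxy.symm))
    refine ⟨D, G.restrict D, .refl, rfl, ?_, ?_⟩
    · rw [edgeSet_restrict, Set.inter_eq_right.2 (hD.trans (G.cut_subset_edgeSet _)), hDm]
    · intro e he
      obtain ⟨a, b, hab, rfl, hb⟩ := hD he.2
      have := hno e b hab hb
      subst this
      exact ⟨he.2, hab⟩

theorem isImmersion_theta_of_le_ncard_cut (hG : G.IsFiniteLoopless) {m : ℕ} (hx : x ∈ V(G))
    (hy : y ∈ V(G)) (hxy : x ≠ y)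
    (hm : ∀ S : Set α, x ∈ S → y ∉ S → m ≤ (G.cut S).ncard) : IsImmersion (theta m) G := by
  classical
  obtain ⟨F, G₁, h1, hV, hE, hl⟩ :=
    exists_reflTransGen_isLifting_of_le_ncard_cut hG.finite_edgeSet hG.finite_vertexSet hm hxy
  have hfin : E(G₁).Finite :=
    (ncard_cut_le_of_reflTransGen_isLifting h1
      (hG.finite_edgeSet.subset restrict_le.edgeSet_mono) ∅).1
  have := hfin.fintype
  -- All edges of `G₁` join `x` and `y`, so the other vertices are isolated and may be deleted.
  have hle : banana x y E(G₁) ≤ G₁ := by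
    refine ⟨?_, ?_⟩
    · simp [Set.insert_subset_iff, hV, hx, hy]
    · intro e a b h
      rw [banana_isLink] at h
      obtain ⟨he, h⟩ := h
      rcases h with ⟨rfl, rfl⟩ | ⟨rfl, rfl⟩
      · exact hl e he
      · exact (hl e he).symm
  have ψ : Fin m ≃ E(G₁) := (Finite.equivFinOfCardEq (by rw [Nat.card_coe_set_eq, hE])).symm
  refine ⟨_, G₁, banana x y E(G₁), restrict_le, h1, hle, rfl, ?_⟩
  refine isIsomorphic_of_bijOn ![x, y] (fun i => ψ i) ⟨?_, ?_, ?_⟩ ⟨?_, ?_, ?_⟩ ?_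
  · intro i _
    fin_cases i <;> simp
  · intro i _ j _ h
    fin_cases i <;> fin_cases j <;> simp_all
  · rintro a (rfl | rfl)
    · exact ⟨0, by simp [theta], rfl⟩
    · exact ⟨1, by simp [theta], rfl⟩
  · exact fun i _ => (ψ i).2
  · exact fun i _ j _ h => ψ.injective (Subtype.ext h)
  · exact fun e he => ⟨ψ.symm ⟨e, he⟩, by simp [theta], by simp⟩
  · intro i a b h
    simp only [theta, banana_isLink] at h
    rcases h.2 with ⟨rfl, rfl⟩ | ⟨rfl, rfl⟩ <;> simp

theorem not_isImmersion_theta_iff (hG : G.IsFiniteLoopless) (k : ℕ) :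
    ¬ IsImmersion (theta (k + 1)) G ↔ G.Separable k := by
  refine ⟨fun h x hx y hy hxy => ?_, fun h => h.not_isImmersion_theta hG.finite_edgeSet⟩
  by_contra! hcon
  exact h (isImmersion_theta_of_le_ncard_cut hG hx hy hxy hcon)

end Lift

/-! ### Separability: subgraphs and the base class -/

section Basic

variable {α : Type u} {β : Type v} {G H : Graph α β} {x y a b : α} {e : β} {k : ℕ}

theorem separable_of_forall_exists
    (h : ∀ x ∈ V(G), ∀ y ∈ V(G), x ≠ y →
      ∃ S : Set α, ¬ (x ∈ S ↔ y ∈ S) ∧ (G.cut S).ncard ≤ k) : G.Separable k := by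
  intro x hx y hy hxy
  obtain ⟨S, hS, hk⟩ := h x hx y hy hxy
  by_cases hxS : x ∈ S
  · exact ⟨S, hxS, by tauto, hk⟩
  · exact ⟨Sᶜ, hxS, fun h => h (by tauto), by rwa [cut_compl]⟩

theorem Separable.mono (hG : G.Separable k) (hE : E(G).Finite) (h : H ≤ G) : H.Separable k := by
  intro x hx y hy hxy
  obtain ⟨S, h1, h2, h3⟩ := hG x (h.vertexSet_mono hx) y (h.vertexSet_mono hy) hxy
  exact ⟨S, h1, h2, (ncard_cut_mono h hE S).trans h3⟩

theorem IsFiniteLoopless.ne_of_isLink (hG : G.IsFiniteLoopless) (h : G.IsLink e a b) : a ≠ b := by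
  rintro rfl
  have := hG.loopless
  exact this.not_isLoopAt e a h

theorem IsFiniteLoopless.of_forall_ne (hV : V(G).Finite) (hE : E(G).Finite)
    (h : ∀ e a b, G.IsLink e a b → a ≠ b) : G.IsFiniteLoopless :=
  ⟨hV, hE, ⟨fun e a ha => h e a a ha rfl⟩⟩

theorem IsFiniteLoopless.mono (hG : G.IsFiniteLoopless) (h : H ≤ G) : H.IsFiniteLoopless :=
  .of_forall_ne (hG.finite_vertexSet.subset h.vertexSet_mono)
    (hG.finite_edgeSet.subset h.edgeSet_mono) fun _ _ _ hl => hG.ne_of_isLink (hl.mono h)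

theorem IsFiniteLoopless.finite_incidenceSet (hG : G.IsFiniteLoopless) (x : α) :
    (G.incidenceSet x).Finite :=
  hG.finite_edgeSet.subset (G.incidenceSet_subset_edgeSet x)

theorem AlmostBounded.separable (h : AlmostBounded k α β G) : G.Separable k := by
  refine separable_of_forall_exists fun x hx y hy hxy => ?_
  have key : ∀ z, G.edgeDegree z ≤ k → (G.cut {z}).ncard ≤ k := by
    intro z hz
    refine (Set.ncard_le_ncard ?_ (h.1.finite_incidenceSet z)).trans hz
    rintro e ⟨a, b, hab, rfl, -⟩
    exact hab.inc_left
  by_cases hxk : G.edgeDegree x ≤ k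
  · exact ⟨{x}, by simpa using hxy.symm, key x hxk⟩
  by_cases hyk : G.edgeDegree y ≤ k
  · exact ⟨{y}, by simpa using hxy, key y hyk⟩
  exact absurd (h.2 ⟨hx, hxk⟩ ⟨hy, hyk⟩) hxy

end Basic

/-! ### Invariance under isomorphism -/

section Iso

variable {α : Type u} {β : Type v} {γ : Type u'} {δ : Type v'} {G : Graph α β} {H : Graph γ δ}
  {k : ℕ}

theorem IsIsomorphic.isFiniteLoopless (h : IsIsomorphic G H) (hH : H.IsFiniteLoopless) :
    G.IsFiniteLoopless := by
  obtain ⟨φ, ψ, hφ⟩ := h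
  have := hH.finite_vertexSet.to_subtype
  have := hH.finite_edgeSet.to_subtype
  have : Finite V(G) := .of_equiv _ φ.symm
  have : Finite E(G) := .of_equiv _ ψ.symm
  refine .of_forall_ne (Set.toFinite _) (Set.toFinite _) ?_
  rintro e a _ h rfl
  exact hH.ne_of_isLink ((hφ ⟨e, h.edge_mem⟩ ⟨a, h.left_mem⟩ ⟨a, h.left_mem⟩).1 h) rfl

theorem IsIsomorphic.separable (h : IsIsomorphic G H) (hH : E(H).Finite) (hS : H.Separable k) :
    G.Separable k := by
  obtain ⟨φ, ψ, hφ⟩ := h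
  intro x hx y hy hxy
  obtain ⟨S, h1, h2, h3⟩ := hS _ (φ ⟨x, hx⟩).2 _ (φ ⟨y, hy⟩).2
    (fun h => hxy (congrArg Subtype.val (φ.injective (Subtype.ext h))))
  refine ⟨{a | ∃ h : a ∈ V(G), (φ ⟨a, h⟩ : γ) ∈ S}, ⟨hx, h1⟩, fun h => h2 h.2, le_trans ?_ h3⟩
  have := (finite_cut hH S).to_subtype
  rw [← Nat.card_coe_set_eq, ← Nat.card_coe_set_eq]
  refine Nat.card_le_card_of_injective
    (fun e => ⟨ψ ⟨e, G.cut_subset_edgeSet _ e.2⟩, ?_⟩) ?_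
  · obtain ⟨a, b, hab, ⟨ha, haS⟩, hb⟩ := e.2
    exact ⟨_, _, (hφ ⟨e, _⟩ ⟨a, ha⟩ ⟨b, hab.right_mem⟩).1 hab, haS,
      fun h => hb ⟨hab.right_mem, h⟩⟩
  · intro e e' h
    have h' : ψ ⟨e, _⟩ = ψ ⟨e', _⟩ := Subtype.ext (Subtype.mk.inj h)
    exact Subtype.ext (Subtype.mk.inj (ψ.injective h'))

end Iso

/-! ### Separability of disjoint unions and edge sums -/

section Sums

variable {α₁ α₂ : Type u} {β₁ β₂ : Type v} {G₁ : Graph α₁ β₁} {G₂ : Graph α₂ β₂} {k : ℕ}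

theorem isFiniteLoopless_disjointUnion (h₁ : G₁.IsFiniteLoopless) (h₂ : G₂.IsFiniteLoopless) :
    (disjointUnion G₁ G₂).IsFiniteLoopless := by
  refine .of_forall_ne ((h₁.finite_vertexSet.image _).union (h₂.finite_vertexSet.image _))
    (((h₁.finite_edgeSet.image .inl).union (h₂.finite_edgeSet.image .inr)).subset ?_) ?_
  · rintro _ ⟨_, _, h | h⟩
    · exact Or.inl ⟨_, h.edge_mem, rfl⟩
    · exact Or.inr ⟨_, h.edge_mem, rfl⟩
  · rintro _ _ _ (h | h)
    · simpa using h₁.ne_of_isLink h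
    · simpa using h₂.ne_of_isLink h

theorem separable_disjointUnion (h₁ : G₁.IsFiniteLoopless) (h₂ : G₂.IsFiniteLoopless)
    (s₁ : G₁.Separable k) (s₂ : G₂.Separable k) : (disjointUnion G₁ G₂).Separable k := by
  have cross : (disjointUnion G₁ G₂).cut (Set.range Sum.inl) = ∅ := by
    rw [Set.eq_empty_iff_forall_notMem]
    rintro _ ⟨_, _, h | h, ha, hb⟩ <;> simp at ha hb
  refine separable_of_forall_exists ?_
  rintro _ (⟨x, hx, rfl⟩ | ⟨x, hx, rfl⟩) _ (⟨y, hy, rfl⟩ | ⟨y, hy, rfl⟩) hxy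
  · obtain ⟨S, hxS, hyS, hS⟩ := s₁ x hx y hy (by rintro rfl; exact hxy rfl)
    refine ⟨Sum.inl '' S, by simp [hxS, hyS], le_trans (le_trans (Set.ncard_le_ncard
      (t := Sum.inl '' G₁.cut S) ?_ ((finite_cut h₁.finite_edgeSet S).image _))
      (Set.ncard_image_le (finite_cut h₁.finite_edgeSet S))) hS⟩
    rintro _ ⟨_, _, h | h, ha, hb⟩
    · exact ⟨_, ⟨_, _, h, by simpa using ha, by simpa using hb⟩, rfl⟩
    · simp at ha
  · exact ⟨Set.range Sum.inl, by simp, by simp [cross]⟩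
  · exact ⟨Set.range Sum.inl, by simp, by simp [cross]⟩
  · obtain ⟨S, hxS, hyS, hS⟩ := s₂ x hx y hy (by rintro rfl; exact hxy rfl)
    refine ⟨Sum.inr '' S, by simp [hxS, hyS], le_trans (le_trans (Set.ncard_le_ncard
      (t := Sum.inr '' G₂.cut S) ?_ ((finite_cut h₂.finite_edgeSet S).image _))
      (Set.ncard_image_le (finite_cut h₂.finite_edgeSet S))) hS⟩
    rintro _ ⟨_, _, h | h, ha, hb⟩
    · simp at ha
    · exact ⟨_, ⟨_, _, h, by simpa using ha, by simpa using hb⟩, rfl⟩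

variable {v₁ : α₁} {v₂ : α₂} {σ : G₁.incidenceSet v₁ ≃ G₂.incidenceSet v₂}

theorem isFiniteLoopless_edgeSum (h₁ : G₁.IsFiniteLoopless) (h₂ : G₂.IsFiniteLoopless) :
    (edgeSum G₁ G₂ v₁ v₂ σ).IsFiniteLoopless := by
  refine .of_forall_ne ((h₁.finite_vertexSet.sdiff.image _).union
    (h₂.finite_vertexSet.sdiff.image _))
    (((h₁.finite_edgeSet.image .inl).union (h₂.finite_edgeSet.image .inr)).subset ?_) ?_
  · rintro _ ⟨_, _, ⟨h, -, -⟩ | ⟨h, -, -⟩ | ⟨h, -, -, -⟩ | ⟨h, -, -, -⟩⟩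
    · exact Or.inl ⟨_, h.edge_mem, rfl⟩
    · exact Or.inr ⟨_, h.edge_mem, rfl⟩
    · exact Or.inl ⟨_, h.edge_mem, rfl⟩
    · exact Or.inl ⟨_, h.edge_mem, rfl⟩
  · rintro _ _ _ (⟨h, -, -⟩ | ⟨h, -, -⟩ | ⟨h, -, -, -⟩ | ⟨h, -, -, -⟩)
    · simpa using h₁.ne_of_isLink h
    · simpa using h₂.ne_of_isLink h
    · simp
    · simp

/-- A set and its complement have the same cut, so the side avoiding `z` can be chosen. With `z` the
vertex that disappears in an edge sum, or the vertex that absorbs a collapsed side, this side is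
unaffected by the operation. -/
theorem Separable.exists_cut_notMem {α : Type u} {β : Type v} {G : Graph α β}
    (hG : G.Separable k) {x y : α} (hx : x ∈ V(G)) (hy : y ∈ V(G)) (hxy : x ≠ y) (z : α) :
    ∃ S : Set α, z ∉ S ∧ ¬ (x ∈ S ↔ y ∈ S) ∧ (G.cut S).ncard ≤ k := by
  obtain ⟨S, hxS, hyS, hS⟩ := hG x hx y hy hxy
  by_cases hz : z ∈ S
  · exact ⟨Sᶜ, fun h => h hz, by simp [hxS, hyS], by rwa [cut_compl]⟩
  · exact ⟨S, hz, by simp [hxS, hyS], hS⟩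

theorem ncard_cut_edgeSum_image_inl_le (h₁ : E(G₁).Finite) {S : Set α₁} (hS : v₁ ∉ S) :
    ((edgeSum G₁ G₂ v₁ v₂ σ).cut (Sum.inl '' S)).ncard ≤ (G₁.cut S).ncard := by
  refine le_trans (Set.ncard_le_ncard (t := Sum.inl '' G₁.cut S) ?_ ((finite_cut h₁ S).image _))
    (Set.ncard_image_le (finite_cut h₁ S))
  rintro _ ⟨_, _, ⟨h, -, -⟩ | ⟨h, -, -⟩ | ⟨h, -, -, -⟩ | ⟨h, -, -, -⟩, ha, hb⟩
  · exact ⟨_, ⟨_, _, h, by simpa using ha, by simpa using hb⟩, rfl⟩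
  · simp at ha
  · exact ⟨_, ⟨_, _, h.symm, by simpa using ha, hS⟩, rfl⟩
  · simp at ha

/-- The lifted edges carry labels from `G₁`, so edges at `v₂` have to be relabelled through `σ.symm`
before the cuts can be compared. -/
theorem ncard_cut_edgeSum_image_inr_le (h₂ : E(G₂).Finite) {S : Set α₂} (hS : v₂ ∉ S) :
    ((edgeSum G₁ G₂ v₁ v₂ σ).cut (Sum.inr '' S)).ncard ≤ (G₂.cut S).ncard := by
  classical
  let g : β₂ → β₁ ⊕ β₂ := fun f =>
    if h : f ∈ G₂.incidenceSet v₂ then .inl (σ.symm ⟨f, h⟩) else .inr f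
  refine le_trans (Set.ncard_le_ncard (t := g '' G₂.cut S) ?_ ((finite_cut h₂ S).image _))
    (Set.ncard_image_le (finite_cut h₂ S))
  rintro _ ⟨_, _, ⟨h, -, -⟩ | ⟨h, hx, hy⟩ | ⟨h, -, -, -⟩ | ⟨h, -, h', -⟩, ha, hb⟩
  · simp at ha
  · refine ⟨_, ⟨_, _, h, by simpa using ha, by simpa using hb⟩, dif_neg ?_⟩
    intro hi
    exact (Inc.eq_or_eq_of_isLink hi h).elim (fun h => hx h.symm) (fun h => hy h.symm)
  · simp at ha
  · refine ⟨_, ⟨_, _, h'.symm, by simpa using ha, hS⟩, ?_⟩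
    refine (dif_pos (show _ ∈ G₂.incidenceSet v₂ from h'.inc_left)).trans ?_
    exact congrArg (fun i : G₁.incidenceSet v₁ => Sum.inl i.1) (σ.symm_apply_apply _)

theorem ncard_cut_edgeSum_range_inl_le (h₁ : G₁.IsFiniteLoopless) :
    ((edgeSum G₁ G₂ v₁ v₂ σ).cut (Set.range Sum.inl)).ncard ≤ G₁.edgeDegree v₁ := by
  refine le_trans (Set.ncard_le_ncard (t := Sum.inl '' G₁.incidenceSet v₁) ?_
    ((h₁.finite_incidenceSet v₁).image _)) (Set.ncard_image_le (h₁.finite_incidenceSet v₁))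
  rintro _ ⟨_, _, ⟨h, -, -⟩ | ⟨h, -, -⟩ | ⟨h, -, -, -⟩ | ⟨h, -, -, -⟩, ha, hb⟩
  · simp at hb
  · simp at ha
  · exact ⟨_, h.inc_left, rfl⟩
  · simp at ha

theorem separable_edgeSum (h₁ : G₁.IsFiniteLoopless) (h₂ : G₂.IsFiniteLoopless)
    (s₁ : G₁.Separable k) (s₂ : G₂.Separable k) (hk : G₁.edgeDegree v₁ ≤ k) :
    (edgeSum G₁ G₂ v₁ v₂ σ).Separable k := by
  have cross := (ncard_cut_edgeSum_range_inl_le (G₂ := G₂) (v₂ := v₂) (σ := σ) h₁).trans hk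
  refine separable_of_forall_exists ?_
  rintro _ (⟨x, hx, rfl⟩ | ⟨x, hx, rfl⟩) _ (⟨y, hy, rfl⟩ | ⟨y, hy, rfl⟩) hxy
  · obtain ⟨S, hv, hS, hSk⟩ := s₁.exists_cut_notMem hx.1 hy.1 (by rintro rfl; exact hxy rfl) v₁
    exact ⟨Sum.inl '' S, by simpa using hS,
      (ncard_cut_edgeSum_image_inl_le h₁.finite_edgeSet hv).trans hSk⟩
  · exact ⟨Set.range Sum.inl, by simp, cross⟩
  · exact ⟨Set.range Sum.inl, by simp, cross⟩
  · obtain ⟨S, hv, hS, hSk⟩ := s₂.exists_cut_notMem hx.1 hy.1 (by rintro rfl; exact hxy rfl) v₂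
    exact ⟨Sum.inr '' S, by simpa using hS,
      (ncard_cut_edgeSum_image_inr_le h₂.finite_edgeSet hv).trans hSk⟩

theorem SumClosure.isFiniteLoopless_and_separable {α : Type u} {β : Type v} {G : Graph α β}
    (h : SumClosure (AlmostBounded k) k α β G) : G.IsFiniteLoopless ∧ G.Separable k := by
  induction h with
  | base G h => exact ⟨h.1, AlmostBounded.separable h⟩
  | sum G₁ G₂ G _ _ h _ _ ih₁ ih₂ =>
    rcases h with h | ⟨k', -, hk, v₁, -, v₂, -, hd, -, σ, h⟩
    · have hf := isFiniteLoopless_disjointUnion ih₁.1 ih₂.1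
      exact ⟨h.isFiniteLoopless hf,
        h.separable hf.finite_edgeSet (separable_disjointUnion ih₁.1 ih₂.1 ih₁.2 ih₂.2)⟩
    · have hf := isFiniteLoopless_edgeSum (v₁ := v₁) (v₂ := v₂) (σ := σ) ih₁.1 ih₂.1
      exact ⟨h.isFiniteLoopless hf, h.separable hf.finite_edgeSet
        (separable_edgeSum ih₁.1 ih₂.1 ih₁.2 ih₂.2 (hd.trans_le hk))⟩

end Sums

/-! ### Decomposition along a minimum cut -/

section Collapse

variable {α : Type u} {β : Type v}

open Classical in
/-- The graph obtained from `G` by identifying all vertices outside `X` with `v`, and deleting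
the loops that arise at `v`. -/
def collapse (G : Graph α β) (X : Set α) (v : α) : Graph α β where
  vertexSet := insert v (X ∩ V(G))
  IsLink e x y := ∃ a b, G.IsLink e a b ∧ (a ∈ X ∨ b ∈ X) ∧
    x = (if a ∈ X then a else v) ∧ y = (if b ∈ X then b else v)
  isLink_symm := by
    refine fun e _ => ⟨?_⟩
    rintro x y ⟨a, b, h, hX, hx, hy⟩
    exact ⟨b, a, h.symm, hX.symm, hy, hx⟩
  eq_or_eq_of_isLink_of_isLink := by
    rintro e _ _ _ _ ⟨a, b, h, -, rfl, rfl⟩ ⟨a', b', h', -, rfl, rfl⟩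
    rcases h.left_eq_or_eq h' with rfl | rfl <;> simp
  left_mem_of_isLink := by
    rintro e x y ⟨a, b, h, -, rfl, -⟩
    by_cases ha : a ∈ X
    · simp [ha, h.left_mem]
    · simp [ha]

variable {G : Graph α β} {X S : Set α} {u v x y a b : α} {e : β} {k : ℕ}

theorem IsLink.collapse (h : G.IsLink e a b) (ha : a ∈ X) (hb : b ∈ X) :
    (G.collapse X v).IsLink e a b :=
  ⟨a, b, h, Or.inl ha, by simp [ha], by simp [hb]⟩

theorem IsLink.collapse_of_notMem (h : G.IsLink e a b) (ha : a ∈ X) (hb : b ∉ X) :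
    (G.collapse X v).IsLink e v a :=
  ⟨b, a, h.symm, Or.inr ha, by simp [hb], by simp [ha]⟩

theorem IsLink.of_collapse (h : (G.collapse X v).IsLink e x y) (hx : x ≠ v) (hy : y ≠ v) :
    G.IsLink e x y ∧ x ∈ X ∧ y ∈ X := by
  obtain ⟨a, b, h, hX, rfl, rfl⟩ := h
  have ha : a ∈ X := by
    by_contra ha
    simp [ha] at hx
  have hb : b ∈ X := by
    by_contra hb
    simp [hb] at hy
  simp [ha, hb, h]

theorem edgeSet_collapse_subset (G : Graph α β) (X : Set α) (v : α) : E(G.collapse X v) ⊆ E(G) := by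
  rintro e ⟨_, _, a, b, h, -⟩
  exact h.edge_mem

theorem incidenceSet_collapse (hv : v ∉ X) : (G.collapse X v).incidenceSet v = G.cut X := by
  ext e
  constructor
  · rintro ⟨_, a, b, h, hX, hva, rfl⟩
    have ha : a ∉ X := by
      intro ha
      rw [if_pos ha] at hva
      exact hv (hva ▸ ha)
    exact ⟨b, a, h.symm, by tauto, ha⟩
  · rintro ⟨a, b, h, ha, hb⟩
    exact (h.collapse_of_notMem ha hb).inc_left

theorem isFiniteLoopless_collapse (hG : G.IsFiniteLoopless) (hv : v ∉ X) :
    (G.collapse X v).IsFiniteLoopless := by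
  refine .of_forall_ne ((hG.finite_vertexSet.inter_of_right X).insert v)
    (hG.finite_edgeSet.subset (G.edgeSet_collapse_subset X v)) ?_
  rintro e _ _ ⟨a, b, h, hX, rfl, rfl⟩
  have := hG.ne_of_isLink h
  by_cases ha : a ∈ X <;> by_cases hb : b ∈ X <;> simp only [ha, hb, if_true, if_false]
  · exact this
  · rintro rfl; exact hv ha
  · rintro rfl; exact hv hb
  · tauto

theorem cut_collapse_subset (hv : v ∉ X) (hS : S ⊆ X) : (G.collapse X v).cut S ⊆ G.cut S := by
  rintro e ⟨_, _, ⟨a, b, h, hX, rfl, rfl⟩, hx, hy⟩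
  have ha : a ∈ X := by
    by_contra ha
    rw [if_neg ha] at hx
    exact hv (hS hx)
  rw [if_pos ha] at hx
  refine ⟨a, b, h, hx, fun hb => hy ?_⟩
  rwa [if_pos (hS hb)]

/-- Collapsing one side of a minimum cut between `u` and `v` preserves separability: minimality
allows one to uncross other cuts. -/
theorem Separable.collapse (hG : G.IsFiniteLoopless) (hs : G.Separable k) (hu : u ∈ X)
    (hv : v ∉ X) (hk : (G.cut X).ncard ≤ k)
    (hmin : ∀ S : Set α, u ∈ S → v ∉ S → (G.cut X).ncard ≤ (G.cut S).ncard) :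
    (G.collapse X v).Separable k := by
  have hle : ∀ S ⊆ X, ((G.collapse X v).cut S).ncard ≤ (G.cut S).ncard := fun S hS =>
    Set.ncard_le_ncard (cut_collapse_subset hv hS) (finite_cut hG.finite_edgeSet S)
  refine separable_of_forall_exists ?_
  rintro x (rfl | ⟨hx, hxV⟩) y (rfl | ⟨hy, hyV⟩) hxy
  · exact absurd rfl hxy
  · exact ⟨X, by tauto, (hle X subset_rfl).trans hk⟩
  · exact ⟨X, by tauto, (hle X subset_rfl).trans hk⟩
  · obtain ⟨S, hvS, hS, hSk⟩ := hs.exists_cut_notMem hxV hyV hxy v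
    refine ⟨X ∩ S, by simpa [hx, hy] using hS, (hle _ Set.inter_subset_left).trans ?_⟩
    -- As `S` avoids `v`, the set `X ∪ S` still separates `u` from `v`, so its cut is at least that
    -- of `X`. Submodularity then bounds the cut of `X ∩ S` by that of `S`.
    have h1 := ncard_cut_inter_add_ncard_cut_union_le hG.finite_edgeSet X S
    have h2 := hmin (X ∪ S) (Or.inl hu) (fun h => h.elim hv hvS)
    omega

/-- If `v` were the only vertex outside `X`, every edge at `v` would lie in the cut of `X`, which is
too small for that. -/
theorem ncard_vertexSet_collapse_lt (hG : G.IsFiniteLoopless) (hvV : v ∈ V(G)) (hv : v ∉ X)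
    (hd : (G.cut X).ncard < G.edgeDegree v) : V(G.collapse X v).ncard < V(G).ncard := by
  refine Set.ncard_lt_ncard ⟨?_, fun hsub => ?_⟩ hG.finite_vertexSet
  · rintro w (rfl | hw)
    exacts [hvV, hw.2]
  · refine absurd hd (not_lt.2 (Set.ncard_le_ncard ?_ (finite_cut hG.finite_edgeSet X)))
    rintro e ⟨w, hw⟩
    rcases hsub hw.right_mem with rfl | h
    · exact absurd rfl (hG.ne_of_isLink hw)
    · exact ⟨w, v, hw.symm, h.1, hv⟩

theorem injective_ite_inl_inr {γ : Type*} (p : γ → Prop) [DecidablePred p] :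
    Function.Injective (fun w => if p w then (Sum.inl w : γ ⊕ γ) else Sum.inr w) := by
  intro w w' h
  dsimp only at h
  split_ifs at h <;> simp_all

/-- A graph is an edge sum of the two graphs obtained by collapsing the sides of a cut. -/
theorem isIsomorphic_edgeSum_collapse (hu : u ∈ X) (hv : v ∉ X)
    (σ : (G.collapse X v).incidenceSet v ≃ (G.collapse Xᶜ u).incidenceSet u)
    (hσ : ∀ e, (σ e : β) = e) :
    IsIsomorphic G (edgeSum (G.collapse X v) (G.collapse Xᶜ u) v u σ) := by
  classical
  have hne : ∀ {w}, w ∈ X → w ≠ v := by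
    rintro w hw rfl
    exact hv hw
  have hne' : ∀ {w}, w ∉ X → w ≠ u := by
    rintro w hw rfl
    exact hw hu
  -- Every edge that meets `X` is sent to the left, because the edge sum labels its cross edges by
  -- the first summand.
  have hlink : ∀ e x y, G.IsLink e x y →
      (edgeSum (G.collapse X v) (G.collapse Xᶜ u) v u σ).IsLink
        (if ∃ a ∈ X, G.Inc e a then .inl e else .inr e)
        (if x ∈ X then .inl x else .inr x) (if y ∈ X then .inl y else .inr y) := by
    intro e x y h
    by_cases hx : x ∈ X
    · have hex : ∃ a ∈ X, G.Inc e a := ⟨x, hx, h.inc_left⟩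
      rw [if_pos hex, if_pos hx]
      by_cases hy : y ∈ X
      · rw [if_pos hy]
        exact .left (h.collapse hx hy) (hne hx) (hne hy)
      · rw [if_neg hy]
        refine .cross (h.collapse_of_notMem hx hy) (hne hx) ?_ (hne' hy)
        rw [hσ]
        exact h.symm.collapse_of_notMem hy (fun h => h hx)
    · rw [if_neg hx]
      by_cases hy : y ∈ X
      · have hex : ∃ a ∈ X, G.Inc e a := ⟨y, hy, h.inc_right⟩
        rw [if_pos hex, if_pos hy]
        refine .cross_symm (h.symm.collapse_of_notMem hy hx) (hne hy) ?_ (hne' hx)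
        rw [hσ]
        exact h.collapse_of_notMem hx (fun h => h hy)
      · have hex : ¬ ∃ a ∈ X, G.Inc e a := by
          rintro ⟨a, ha, hi⟩
          rcases hi.eq_or_eq_of_isLink h with rfl | rfl <;> contradiction
        rw [if_neg hex, if_neg hy]
        exact .right (h.collapse hx hy) (hne' hx) (hne' hy)
  have hinl : ∀ {e x}, (G.collapse X v).IsLink e v x → x ≠ v →
      e ∈ E(G) ∧ ∃ a ∈ X, G.Inc e a := by
    rintro e _ ⟨a, b, h, -, -, rfl⟩ hx
    have hb : b ∈ X := by
      by_contra hb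
      simp [hb] at hx
    exact ⟨h.edge_mem, b, hb, h.inc_right⟩
  refine isIsomorphic_of_bijOn (fun w => if w ∈ X then .inl w else .inr w)
    (fun e => if ∃ a ∈ X, G.Inc e a then .inl e else .inr e) ⟨?_, ?_, ?_⟩ ⟨?_, ?_, ?_⟩ hlink
  · intro w hw
    by_cases h : w ∈ X
    · exact Or.inl ⟨w, ⟨Or.inr ⟨h, hw⟩, hne h⟩, by simp [h]⟩
    · exact Or.inr ⟨w, ⟨Or.inr ⟨h, hw⟩, hne' h⟩, by simp [h]⟩
  · exact (injective_ite_inl_inr _).injOn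
  · rintro _ (⟨w, ⟨rfl | h, hw⟩, rfl⟩ | ⟨w, ⟨rfl | h, hw⟩, rfl⟩)
    · exact absurd rfl hw
    · exact ⟨w, h.2, if_pos h.1⟩
    · exact absurd rfl hw
    · exact ⟨w, h.2, if_neg h.1⟩
  · intro e he
    obtain ⟨a, b, h⟩ := G.exists_isLink_of_mem_edgeSet he
    exact (hlink e a b h).edge_mem
  · exact (injective_ite_inl_inr _).injOn
  · rintro _ ⟨_, _, ⟨h, hx, hy⟩ | ⟨h, hx, hy⟩ | ⟨h, hx, -, -⟩ | ⟨h, hx, -, -⟩⟩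
    · obtain ⟨h, hxX, -⟩ := h.of_collapse hx hy
      exact ⟨_, h.edge_mem, if_pos ⟨_, hxX, h.inc_left⟩⟩
    · obtain ⟨h, hxX, hyX⟩ := h.of_collapse hx hy
      refine ⟨_, h.edge_mem, if_neg ?_⟩
      rintro ⟨a, ha, hi⟩
      rcases hi.eq_or_eq_of_isLink h with rfl | rfl
      exacts [hxX ha, hyX ha]
    · exact ⟨_, (hinl h hx).1, if_pos (hinl h hx).2⟩
    · exact ⟨_, (hinl h hx).1, if_pos (hinl h hx).2⟩

/-- A graph is the disjoint union of the graphs induced by the sides of an empty cut. -/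
theorem isIsomorphic_disjointUnion_induce (hX : G.cut X = ∅) :
    IsIsomorphic G (disjointUnion (G.induce (V(G) ∩ X)) (G.induce (V(G) \ X))) := by
  classical
  have hiff : ∀ {e x y}, G.IsLink e x y → (x ∈ X ↔ y ∈ X) := by
    intro e x y h
    by_contra hc
    rw [← h.mem_cut_iff, hX] at hc
    exact hc
  have hlink : ∀ e x y, G.IsLink e x y →
      (disjointUnion (G.induce (V(G) ∩ X)) (G.induce (V(G) \ X))).IsLink
        (if ∃ a ∈ X, G.Inc e a then .inl e else .inr e)
        (if x ∈ X then .inl x else .inr x) (if y ∈ X then .inl y else .inr y) := by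
    intro e x y h
    by_cases hx : x ∈ X
    · have hy := (hiff h).1 hx
      have hex : ∃ a ∈ X, G.Inc e a := ⟨x, hx, h.inc_left⟩
      rw [if_pos hex, if_pos hx, if_pos hy]
      exact .left ⟨h, ⟨h.left_mem, hx⟩, ⟨h.right_mem, hy⟩⟩
    · have hy := mt (hiff h).2 hx
      have hex : ¬ ∃ a ∈ X, G.Inc e a := by
        rintro ⟨a, ha, hi⟩
        rcases hi.eq_or_eq_of_isLink h with rfl | rfl <;> contradiction
      rw [if_neg hex, if_neg hx, if_neg hy]
      exact .right ⟨h, ⟨h.left_mem, hx⟩, ⟨h.right_mem, hy⟩⟩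
  refine isIsomorphic_of_bijOn (fun w => if w ∈ X then .inl w else .inr w)
    (fun e => if ∃ a ∈ X, G.Inc e a then .inl e else .inr e) ⟨?_, ?_, ?_⟩ ⟨?_, ?_, ?_⟩ hlink
  · intro w hw
    by_cases h : w ∈ X
    · exact Or.inl ⟨w, ⟨hw, h⟩, by simp [h]⟩
    · exact Or.inr ⟨w, ⟨hw, h⟩, by simp [h]⟩
  · exact (injective_ite_inl_inr _).injOn
  · rintro _ (⟨w, h, rfl⟩ | ⟨w, h, rfl⟩)
    · exact ⟨w, h.1, if_pos h.2⟩
    · exact ⟨w, h.1, if_neg h.2⟩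
  · intro e he
    obtain ⟨a, b, h⟩ := G.exists_isLink_of_mem_edgeSet he
    exact (hlink e a b h).edge_mem
  · exact (injective_ite_inl_inr _).injOn
  · rintro _ ⟨_, _, ⟨h, hx, hy⟩ | ⟨h, hx, hy⟩⟩
    · exact ⟨_, h.edge_mem, if_pos ⟨_, hx.2, h.inc_left⟩⟩
    · refine ⟨_, h.edge_mem, if_neg ?_⟩
      rintro ⟨a, ha, hi⟩
      rcases hi.eq_or_eq_of_isLink h with rfl | rfl
      exacts [hx.2 ha, hy.2 ha]

theorem Separable.exists_minimum_cut (hs : G.Separable k) (hu : u ∈ V(G)) (hv : v ∈ V(G))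
    (huv : u ≠ v) :
    ∃ X : Set α, u ∈ X ∧ v ∉ X ∧ (G.cut X).ncard ≤ k ∧
      ∀ S : Set α, u ∈ S → v ∉ S → (G.cut X).ncard ≤ (G.cut S).ncard := by
  classical
  obtain ⟨S₀, hu₀, hv₀, hk⟩ := hs u hu v hv huv
  have hex : ∃ n, ∃ S : Set α, u ∈ S ∧ v ∉ S ∧ (G.cut S).ncard = n := ⟨_, S₀, hu₀, hv₀, rfl⟩
  obtain ⟨X, huX, hvX, hX⟩ := Nat.find_spec hex
  have hmin : ∀ S : Set α, u ∈ S → v ∉ S → (G.cut X).ncard ≤ (G.cut S).ncard :=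
    fun S h h' => hX.trans_le (Nat.find_min' hex ⟨S, h, h', rfl⟩)
  exact ⟨X, huX, hvX, (hmin S₀ hu₀ hv₀).trans hk, hmin⟩

theorem Separable.sumClosure (hG : G.IsFiniteLoopless) (hs : G.Separable k) :
    SumClosure (AlmostBounded k) k α β G := by
  induction hn : V(G).ncard using Nat.strong_induction_on generalizing G with
  | _ n ih =>
  subst hn
  by_cases hA : {x ∈ V(G) | ¬ G.edgeDegree x ≤ k}.Subsingleton
  · exact .base G ⟨hG, hA⟩
  rw [Set.not_subsingleton_iff] at hA
  obtain ⟨u, ⟨huV, hu⟩, v, ⟨hvV, hv⟩, huv⟩ := hA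
  obtain ⟨X, huX, hvX, hXk, hmin⟩ := hs.exists_minimum_cut huV hvV huv
  -- An empty cut is treated apart because a `k'`-edge sum requires `1 ≤ k'`.
  by_cases hX : G.cut X = ∅
  · have hle₁ : G.induce (V(G) ∩ X) ≤ G := induce_le Set.inter_subset_left
    have hle₂ : G.induce (V(G) \ X) ≤ G := induce_le Set.sdiff_subset
    have hlt₁ : (V(G) ∩ X).ncard < V(G).ncard :=
      Set.ncard_lt_ncard ⟨Set.inter_subset_left, fun h => hvX (h hvV).2⟩ hG.finite_vertexSet
    have hlt₂ : (V(G) \ X).ncard < V(G).ncard :=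
      Set.ncard_lt_ncard ⟨Set.sdiff_subset, fun h => (h huV).2 huX⟩ hG.finite_vertexSet
    exact .sum _ _ G (ih _ hlt₁ (hG.mono hle₁) (hs.mono hG.finite_edgeSet hle₁) rfl)
      (ih _ hlt₂ (hG.mono hle₂) (hs.mono hG.finite_edgeSet hle₂) rfl)
      (Or.inl (isIsomorphic_disjointUnion_induce hX)) hlt₁ hlt₂
  · have huX' : u ∉ Xᶜ := fun h => h huX
    have hi₁ : (G.collapse X v).incidenceSet v = G.cut X := incidenceSet_collapse hvX
    have hi₂ : (G.collapse Xᶜ u).incidenceSet u = G.cut X := by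
      rw [incidenceSet_collapse huX', cut_compl]
    have hlt₁ : V(G.collapse X v).ncard < V(G).ncard :=
      ncard_vertexSet_collapse_lt hG hvV hvX (by omega)
    have hlt₂ : V(G.collapse Xᶜ u).ncard < V(G).ncard :=
      ncard_vertexSet_collapse_lt hG huV huX' (by rw [cut_compl]; omega)
    -- The complement of `X` is a minimum cut between `v` and `u`, so the same lemma applies with
    -- the two vertices exchanged.
    have hs₂ : (G.collapse Xᶜ u).Separable k := by
      refine hs.collapse hG (u := v) hvX huX' (by rwa [cut_compl]) fun S h h' => ?_
      rw [cut_compl, ← cut_compl G S]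
      exact hmin Sᶜ h' (fun h'' => h'' h)
    refine .sum _ _ G
      (ih _ hlt₁ (isFiniteLoopless_collapse hG hvX) (hs.collapse hG huX hvX hXk hmin) rfl)
      (ih _ hlt₂ (isFiniteLoopless_collapse hG huX') hs₂ rfl) (Or.inr ?_) hlt₁ hlt₂
    refine ⟨(G.cut X).ncard, ?_, hXk, v, Set.mem_insert _ _, u, Set.mem_insert _ _,
      by rw [edgeDegree, hi₁], by rw [edgeDegree, hi₂],
      -- Collapsing keeps edge labels, so the edges at both collapsed vertices are literally the
      -- cut, and `σ` is the identity on labels.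
      Equiv.setCongr (hi₁.trans hi₂.symm),
      isIsomorphic_edgeSum_collapse huX hvX _ fun e => rfl⟩
    exact (Set.ncard_pos (finite_cut hG.finite_edgeSet X)).2 (Set.nonempty_iff_ne_empty.2 hX)

end Collapse

end Graph

theorem mainTheorem2 {α : Type u} {β : Type v} (G : Graph α β) (hG : G.IsFiniteLoopless) (k : ℕ) :
    ¬ Graph.IsImmersion (Graph.theta (k + 1)) G ↔
      Graph.SumClosure (Graph.AlmostBounded k) k α β G := by
  rw [Graph.not_isImmersion_theta_iff hG k]
  exact ⟨fun h => h.sumClosure hG, fun h => h.isFiniteLoopless_and_separable.2⟩
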